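/- Let $R$ be a Noetherian integral domain that is Cohen–Macaulay (for every prime $\mathfrak p$, the local ring $R_{\mathfrak p}$ satisfies $\operatorname{depth} R_{\mathfrak p} = \dim R_{\mathfrak p}$, where for a local ring $(A,\mathfrak n)$ one sets $\operatorname{depth} A = \min\{i : \operatorname{Ext}^i_A(A/\mathfrak n, A) \neq 0\}$), and suppose that $\dim R_{\mathfrak m} = 2$ for every maximal ideal $\mathfrak m$ of $R$. Let $G$ be a finite edge-labeled graph over $R$: finite sets $V$ of vertices and $E$ of edges (multiple edges and loops are allowed), with each edge $e$, joining vertices $u$ and $v$ in an arbitrary fixed orientation, labeled by an ideal $I_e \subseteq R$. Assume that every label $I_e$ is a non-zero principal ideal. Let $$R_G = \ker\Bigl(R^V \to \bigoplus_{e \in E} R/I_e,\quad (r_v)_{v\in V} \mapsto (\overline{r_u - r_v})_{e = uv \in E}\Bigr)$$ be the $R$-module of generalized splines on $G$. If $R_G$ has finite projective dimension over $R$, then $R_G$ is a finitely generated projective $R$-module. In particular, if every finitely generated projective $R$-module is free, then $R_G$ is a free $R$-module. -/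

import Mathlib

universe u v w

/-- The depth of a module `M` over a local ring `(R, 𝔪)`: the least `i` such that
`Ext^i_R(R/𝔪, M) ≠ 0`, with value `⊤` if there is no such `i`. -/
noncomputable def localDepth (R : Type u) [CommRing R] [IsLocalRing R]
    (M : Type u) [AddCommGroup M] [Module R M] : ℕ∞ :=
  ⨅ (i : ℕ) (_ : Nontrivial (CategoryTheory.Abelian.Ext
    (ModuleCat.of R (R ⧸ IsLocalRing.maximalIdeal R)) (ModuleCat.of R M) i)), (i : ℕ∞)

/-- A Noetherian local ring is Cohen–Macaulay if its depth as a module over itself is its Krull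
dimension. -/
structure IsCohenMacaulayLocal (R : Type u) [CommRing R] [IsLocalRing R] : Prop where
  isNoetherianRing : IsNoetherianRing R
  depth_eq_dim : (localDepth R R : WithBot ℕ∞) = ringKrullDim R

/-- A Noetherian ring is Cohen–Macaulay if all its localizations at prime ideals are. -/
structure IsCohenMacaulay (R : Type u) [CommRing R] : Prop where
  isNoetherianRing : IsNoetherianRing R
  isCohenMacaulayLocal : ∀ (p : Ideal R) [p.IsPrime],
    IsCohenMacaulayLocal (Localization.AtPrime p)

/-- An edge-labeled graph over `R` with vertex set `V` and edge set `E`: each edge has two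
endpoints (listed according to a fixed orientation) and is labeled by an ideal of `R`. Multiple
edges and loops are allowed. -/
structure EdgeLabeledGraph (R : Type u) [CommRing R] (V : Type v) (E : Type w) where
  src : E → V
  tgt : E → V
  label : E → Ideal R

namespace EdgeLabeledGraph

variable {R : Type u} [CommRing R] {V : Type v} {E : Type w}

/-- The potential morphism `R^V → ∏ₑ R/I_e`, sending `(r_v)_v` to the family of classes of
`r_u - r_v` in `R/I_e`, for `e` an edge from `u` to `v`. For a finite edge set the product
is the direct sum. -/
def potentialMap (G : EdgeLabeledGraph R V E) : (V → R) →ₗ[R] ((e : E) → R ⧸ G.label e) :=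
  LinearMap.pi fun e =>
    (Submodule.mkQ (G.label e)).comp
      (LinearMap.proj (R := R) (φ := fun _ : V => R) (G.src e) - LinearMap.proj (G.tgt e))

/-- The `R`-module `R_G` of generalized splines: the kernel of the potential morphism. -/
def splines (G : EdgeLabeledGraph R V E) : Submodule R (V → R) :=
  LinearMap.ker G.potentialMap

theorem mem_splines (G : EdgeLabeledGraph R V E) (f : V → R) :
    f ∈ G.splines ↔ ∀ e, f (G.src e) - f (G.tgt e) ∈ G.label e := by
  rw [splines, LinearMap.mem_ker, funext_iff]
  refine forall_congr' fun e => ?_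
  exact Submodule.Quotient.mk_eq_zero (G.label e)

end EdgeLabeledGraph

open CategoryTheory IsLocalRing

/-! Projectivity is checked at each maximal ideal, where Cohen–Macaulayness in dimension two gives a
regular pair x, y with a nonzero socle class s in A/(x, y). The splines inherit this pair: if y m =
x m' with m, m' splines, then locally m = x F coordinatewise. On an edge with label (a), both x and
y carry F_u - F_v into (a); cancelling a and using regularity again puts F_u - F_v in (a). This is
where principal non-zero labels enter (`isRegularPair_splines`).

A direct form of Auslander–Buchsbaum finishes (`free_of_hasProjectiveDimensionLE`). By induction on
projective dimension, the kernel K of a minimal cover of M is free. If K ≠ 0, a basis vector b of K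
has entries in the maximal ideal, so s b = x p + y q in the cover. Regularity of the pair on M lets
p and q be moved into K, and the b-coordinate reads s ∈ (x, y), a contradiction. -/

/-- Every finite module over a local ring has a finite free cover whose kernel has no element
with a unit coordinate. -/
theorem exists_minimal_cover {A : Type u} [CommRing A] [IsLocalRing A]
    {M : Type v} [AddCommGroup M] [Module A M] [Module.Finite A M] :
    ∃ (n : ℕ) (f : (Fin n → A) →ₗ[A] M), Function.Surjective f ∧
      ∀ c ∈ LinearMap.ker f, ∀ i, c i ∈ maximalIdeal A := by
  classical
  have hex : ∃ n : ℕ, ∃ f : (Fin n → A) →ₗ[A] M, Function.Surjective f :=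
    Module.Finite.exists_fin' A M
  obtain ⟨f, hf⟩ := Nat.find_spec hex
  have hmin := fun m => Nat.find_min hex (m := m)
  generalize Nat.find hex = n at f hf hmin
  refine ⟨n, f, hf, fun c hc i => ?_⟩
  by_contra hci
  rw [mem_maximalIdeal, mem_nonunits_iff, not_not] at hci
  obtain _ | k := n
  · exact i.elim0
  let ins : (Fin k → A) →ₗ[A] (Fin (k + 1) → A) :=
    { toFun := fun w => i.insertNth 0 w
      map_add' := fun a b => by
        ext j; refine Fin.succAboveCases i ?_ (fun j => ?_) j <;> simp
      map_smul' := fun a b => by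
        ext j; refine Fin.succAboveCases i ?_ (fun j => ?_) j <;> simp }
  -- A relation with a unit coordinate makes the `i`-th generator redundant, against minimality of
  -- the number of generators.
  refine hmin k k.lt_succ_self ⟨f.comp ins, fun m => ?_⟩
  obtain ⟨a, rfl⟩ := hf m
  obtain ⟨t, ht⟩ := hci.exists_left_inv
  refine ⟨i.removeNth (a - (a i * t) • c), ?_⟩
  have h0 : (a - (a i * t) • c) i = 0 := by
    simp only [Pi.sub_apply, Pi.smul_apply, smul_eq_mul, mul_assoc, ht, mul_one, sub_self]
  have h1 : i.insertNth 0 (i.removeNth (a - (a i * t) • c)) = a - (a i * t) • c := by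
    conv_lhs => rw [← h0]
    exact Fin.insertNth_self_removeNth _ _
  change f (i.insertNth 0 _) = _
  rw [h1, map_sub, map_smul, LinearMap.mem_ker.mp hc, smul_zero, sub_zero]

/-! ### Regular pairs -/

/-- `x` is regular on `M` and `y` is regular on `M / xM`. -/
structure IsRegularPair {A : Type u} [CommRing A] (x y : A) (M : Type v) [AddCommGroup M]
    [Module A M] : Prop where
  eq_zero : ∀ m : M, x • m = 0 → m = 0
  exists_smul_eq : ∀ m m' : M, y • m = x • m' → ∃ z : M, m = x • z

theorem IsRegularPair.of_linearEquiv {A : Type u} [CommRing A] {x y : A} {M : Type v}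
    [AddCommGroup M] [Module A M] {N : Type w} [AddCommGroup N] [Module A N]
    (h : IsRegularPair x y M) (e : M ≃ₗ[A] N) : IsRegularPair x y N where
  eq_zero m hm := by
    have := h.eq_zero (e.symm m) (by rw [← map_smul, hm, map_zero])
    simpa using this
  exists_smul_eq m m' hm := by
    obtain ⟨z, hz⟩ := h.exists_smul_eq (e.symm m) (e.symm m') (by simp only [← map_smul, hm])
    exact ⟨e z, by rw [← map_smul, ← hz, e.apply_symm_apply]⟩

theorem IsRegularPair.pi {A : Type u} [CommRing A] {x y : A} {ι : Type w}
    (h : IsRegularPair x y A) : IsRegularPair x y (ι → A) where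
  eq_zero m hm := funext fun i => h.eq_zero (m i) (congrFun hm i)
  exists_smul_eq m m' hm := by
    choose z hz using fun i => h.exists_smul_eq (m i) (m' i) (congrFun hm i)
    exact ⟨z, funext hz⟩

/-- Rescaling a regular pair by units. -/
theorem IsRegularPair.mul_units {A : Type u} [CommRing A] {x y : A} {M : Type v}
    [AddCommGroup M] [Module A M] (h : IsRegularPair x y M) (s t : Aˣ) :
    IsRegularPair (x * s) (y * t) M where
  eq_zero m hm := by
    rw [mul_smul] at hm
    have := h.eq_zero _ hm
    simpa using congrArg ((↑s⁻¹ : A) • ·) this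
  exists_smul_eq m m' hm := by
    rw [mul_smul, mul_smul] at hm
    obtain ⟨z, hz⟩ := h.exists_smul_eq _ _ hm
    refine ⟨(↑t⁻¹ : A) • (↑s⁻¹ : A) • z, ?_⟩
    have := congrArg ((↑t⁻¹ : A) • ·) hz
    simp only [smul_smul, Units.inv_mul, one_smul] at this
    rw [this]
    simp only [smul_smul]
    congr 1
    linear_combination (-(x * ↑t⁻¹) : A) * s.mul_inv

/-- If `M` is covered by `F` with kernel `K`, then a pair regular on `F` whose first element is
regular on `M` is regular on `K`. -/
theorem IsRegularPair.ker {A : Type u} [CommRing A] {x y : A} {F : Type v} [AddCommGroup F]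
    [Module A F] {M : Type w} [AddCommGroup M] [Module A M] (hF : IsRegularPair x y F)
    (hM : ∀ m : M, x • m = 0 → m = 0) (f : F →ₗ[A] M) :
    IsRegularPair x y (LinearMap.ker f) where
  eq_zero m hm := Subtype.ext (hF.eq_zero m (congrArg Subtype.val hm))
  exists_smul_eq m m' hm := by
    obtain ⟨z, hz⟩ := hF.exists_smul_eq m m' (congrArg Subtype.val hm)
    -- `z` lies in the kernel because `x` kills `f z`.
    refine ⟨⟨z, hM _ ?_⟩, Subtype.ext hz⟩
    rw [← map_smul, ← hz]
    exact m.2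

/-! ### Freeness from finite projective dimension -/

/-- Over a Noetherian local ring with a regular pair `x, y` such that `A / (x, y)` has a nonzero
socle, a finite module of finite projective dimension on which `x, y` is regular is free. -/
theorem IsRegularPair.free_of_hasProjectiveDimensionLE {A : Type u} [CommRing A] [IsLocalRing A]
    [IsNoetherianRing A] {x y s : A} (hA : IsRegularPair x y A)
    (hs : s ∉ Ideal.span {x, y}) (hs' : ∀ c ∈ maximalIdeal A, s * c ∈ Ideal.span {x, y})
    (n : ℕ) (M : ModuleCat.{u} A) [Module.Finite A M] [hpd : HasProjectiveDimensionLE M n]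
    (hM : IsRegularPair x y M) : Module.Free A M := by
  induction n generalizing M with
  | zero =>
    simp only [HasProjectiveDimensionLE, zero_add] at hpd
    rw [← projective_iff_hasProjectiveDimensionLT_one, ← IsProjective.iff_projective] at hpd
    exact Module.free_of_flat_of_isLocalRing
  | succ n ih =>
    obtain ⟨k, f, hf, hker⟩ := exists_minimal_cover (A := A) (M := M)
    have hS := LinearMap.shortExact_shortComplexKer hf
    have hproj : Projective f.shortComplexKer.X₂ := by
      rw [← IsProjective.iff_projective]
      exact inferInstanceAs (Module.Projective A (Fin k → A))
    have hpdK : HasProjectiveDimensionLE (ModuleCat.of A (LinearMap.ker f)) n :=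
      (hS.hasProjectiveDimensionLT_X₃_iff n hproj).mp hpd
    have hK : Module.Free A (LinearMap.ker f) :=
      ih (ModuleCat.of A (LinearMap.ker f)) (hA.pi.ker hM.eq_zero f)
    suffices h : LinearMap.ker f = ⊥ from
      Module.Free.of_equiv (LinearEquiv.ofBijective f ⟨LinearMap.ker_eq_bot.mp h, hf⟩)
    let b := Module.Free.chooseBasis A (LinearMap.ker f)
    by_contra hbot
    have : Nontrivial (LinearMap.ker f) := Submodule.nontrivial_iff_ne_bot.mpr hbot
    obtain ⟨j⟩ := b.index_nonempty
    have hc : ∀ i, ∃ p q, p * x + q * y = s * (b j).1 i := fun i =>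
      Ideal.mem_span_pair.mp (hs' _ (hker _ (b j).2 i))
    choose p q hpq using hc
    have hvec : s • (b j).1 = x • p + y • q := by
      ext i
      simp only [Pi.smul_apply, Pi.add_apply, smul_eq_mul, ← hpq]
      ring
    have h0 : x • f p + y • f q = 0 := by
      rw [← map_smul, ← map_smul, ← map_add, ← hvec, map_smul, LinearMap.mem_ker.mp (b j).2,
        smul_zero]
    obtain ⟨z, hz⟩ := hM.exists_smul_eq (f q) (-f p) (by
      rw [smul_neg]; exact eq_neg_of_add_eq_zero_right h0)
    have h1 : f p + y • z = 0 := hM.eq_zero _ (by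
      rw [smul_add, smul_comm x y z, ← hz, h0])
    obtain ⟨g, rfl⟩ := hf z
    -- Adding the Koszul relation `(y • g, -x • g)` to `(p, q)` moves both into the kernel and
    -- leaves `x • p + y • q` unchanged.
    let k₁ : LinearMap.ker f := ⟨p + y • g, by rw [LinearMap.mem_ker, map_add, map_smul, h1]⟩
    let k₂ : LinearMap.ker f := ⟨q - x • g, by
      rw [LinearMap.mem_ker, map_sub, map_smul, hz, sub_self]⟩
    have h2 : s • b j = x • k₁ + y • k₂ := by
      refine Subtype.ext (hvec.trans ?_)
      change _ = x • (p + y • g) + y • (q - x • g)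
      rw [smul_add, smul_sub, smul_comm x y g]
      abel
    have h3 := congrArg (fun v => b.repr v j) h2
    simp only [map_smul, map_add, Module.Basis.repr_self, Finsupp.smul_apply, Finsupp.add_apply,
      Finsupp.single_eq_same, smul_eq_mul, mul_one] at h3
    exact hs (Ideal.mem_span_pair.mpr ⟨b.repr k₁ j, b.repr k₂ j, by rw [h3, mul_comm x, mul_comm y]⟩)

/-! ### Socles and Cohen–Macaulay local rings -/

/-- A zero-dimensional quotient of a Noetherian local ring has a nonzero socle. -/
theorem exists_socle_of_ringKrullDim_quotient {A : Type u} [CommRing A] [IsLocalRing A]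
    [IsNoetherianRing A] (J : Ideal A) (h : ringKrullDim (A ⧸ J) = 0) :
    ∃ s ∉ J, ∀ c ∈ maximalIdeal A, s * c ∈ J := by
  have hnt : Nontrivial (A ⧸ J) := by
    by_contra hsub
    rw [not_nontrivial_iff_subsingleton] at hsub
    rw [ringKrullDim_eq_bot_of_subsingleton] at h
    exact absurd h (by decide)
  -- An associated prime of the quotient is maximal in dimension zero; `s` lifts an element whose
  -- annihilator it is.
  obtain ⟨P, hP⟩ := associatedPrimes.nonempty (A ⧸ J) (A ⧸ J)
  have hP' : IsAssociatedPrime P (A ⧸ J) := hP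
  obtain ⟨hprime, b, hb⟩ := isAssociatedPrime_iff.mp hP'
  have hdim : Ring.KrullDimLE 0 (A ⧸ J) := by
    rw [Ring.krullDimLE_iff, h]; rfl
  have hmax : P.IsMaximal := inferInstance
  have hcm := Ideal.comap_isMaximal_of_surjective (Ideal.Quotient.mk J)
    Ideal.Quotient.mk_surjective (K := P)
  obtain ⟨s, rfl⟩ := Ideal.Quotient.mk_surjective b
  refine ⟨s, fun hsJ => hprime.ne_top ?_, fun c hc => ?_⟩
  · rw [hb, Ideal.Quotient.eq_zero_iff_mem.mpr hsJ]
    ext; simp [Submodule.mem_colon_singleton]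
  · rw [← IsLocalRing.eq_maximalIdeal hcm, Ideal.mem_comap, hb,
      Submodule.mem_colon_singleton, Submodule.mem_bot, smul_eq_mul, ← map_mul] at hc
    rw [mul_comm]
    exact Ideal.Quotient.eq_zero_iff_mem.mp hc

/-- A two-dimensional Cohen–Macaulay local ring has a regular pair generating an ideal whose
quotient has a nonzero socle. -/
theorem IsCohenMacaulayLocal.exists_isRegularPair {A : Type u} [CommRing A] [IsLocalRing A]
    (hA : IsCohenMacaulayLocal A) (hdim : ringKrullDim A = 2) :
    ∃ x y s : A, IsRegularPair x y A ∧ s ∉ Ideal.span {x, y} ∧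
      ∀ c ∈ maximalIdeal A, s * c ∈ Ideal.span {x, y} := by
  have := hA.isNoetherianRing
  have hdepth : localDepth A A = 2 := by
    have h := hA.depth_eq_dim
    rw [hdim] at h
    exact WithBot.coe_injective h
  have hext : ∀ i < 2, Subsingleton (Abelian.Ext (ModuleCat.of A (A ⧸ maximalIdeal A))
      (ModuleCat.of A A) i) := by
    intro i hi
    by_contra hne
    rw [not_subsingleton_iff_nontrivial] at hne
    have : localDepth A A ≤ i := iInf₂_le i hne
    rw [hdepth] at this
    have h2 : 2 ≤ i := by exact_mod_cast this
    omega
  -- Rees: vanishing of Ext in degrees 0 and 1 yields a regular sequence of length two.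
  obtain ⟨rs, hlen, hmem, hreg⟩ := ModuleCat.exists_isRegular_of_exists_subsingleton_ext
    (maximalIdeal A) 2 (ModuleCat.of A A)
    (by
      change maximalIdeal A • (⊤ : Ideal A) < ⊤
      rw [smul_eq_mul, Ideal.mul_top]
      exact lt_top_iff_ne_top.mpr (maximalIdeal.isMaximal A).ne_top)
    (ModuleCat.of A (A ⧸ maximalIdeal A))
    (by
      change Module.support A (A ⧸ maximalIdeal A) = _
      rw [Module.support_eq_zeroLocus, Ideal.annihilator_quotient]) hext
  obtain ⟨x, y, rfl⟩ := List.length_eq_two.mp hlen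
  replace hreg : RingTheory.Sequence.IsRegular A [x, y] := hreg
  have hspan : Ideal.ofList [x, y] = Ideal.span {x, y} := by
    rw [Ideal.ofList_cons, Ideal.ofList_singleton, Ideal.span_insert]
  have h0 := ringKrullDim_add_length_eq_ringKrullDim_of_isRegular [x, y] hreg
  rw [hdim, hspan] at h0
  have h1 : ringKrullDim (A ⧸ Ideal.span {x, y}) = 0 := by
    change _ + ((2 : ℕ) : WithBot ℕ∞) = ((2 : ℕ) : WithBot ℕ∞) at h0
    generalize ringKrullDim (A ⧸ Ideal.span {x, y}) = d at h0
    induction d with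
    | bot => simp at h0
    | coe d =>
      induction d with
      | top => exact absurd h0 (by decide)
      | coe d =>
        have h2 : (d : ℕ∞) + 2 = 2 := WithBot.coe_injective h0
        replace h2 : d + 2 = 2 := by exact_mod_cast h2
        rw [show d = 0 by omega]
        rfl
  obtain ⟨s, hs, hs'⟩ := exists_socle_of_ringKrullDim_quotient _ h1
  refine ⟨x, y, s, ⟨fun m hm => ?_, fun m m' hm => ?_⟩, hs, hs'⟩
  · have h := hreg.toIsWeaklyRegular
    rw [RingTheory.Sequence.isWeaklyRegular_cons_iff] at h
    exact h.1.right_eq_zero_of_smul hm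
  · have h := hreg.toIsWeaklyRegular
    rw [RingTheory.Sequence.isWeaklyRegular_cons_iff,
      RingTheory.Sequence.isWeaklyRegular_singleton_iff] at h
    have h2 := h.2.right_eq_zero_of_smul (x := Submodule.Quotient.mk m) (by
      rw [← Submodule.Quotient.mk_smul, hm, Submodule.Quotient.mk_eq_zero]
      exact Submodule.smul_mem_pointwise_smul _ _ _ trivial)
    rw [Submodule.Quotient.mk_eq_zero, Submodule.mem_smul_pointwise_iff_exists] at h2
    obtain ⟨z, -, hz⟩ := h2
    exact ⟨z, hz.symm⟩

/-! ### Localization and splines -/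

/-- The defining property of a regular pair `x, y` in the localization of `M` at `S`, with
denominators cleared, implies the property for the localized module. -/
theorem IsRegularPair.localizedModule {R : Type u} [CommRing R] (S : Submonoid R) {x y : R}
    {M : Type v} [AddCommGroup M] [Module R M] (h0 : ∀ m : M, x • m = 0 → m = 0)
    (h : ∀ m m' : M, y • m = x • m' → ∃ t ∈ S, ∃ z : M, t • m = x • z) :
    IsRegularPair (algebraMap R (Localization S) x) (algebraMap R (Localization S) y)
      (LocalizedModule S M) where
  eq_zero m hm := by
    induction m using LocalizedModule.induction_on with | h m s => ?_
    rw [algebraMap_smul, LocalizedModule.smul'_mk, ← LocalizedModule.zero_mk 1,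
      LocalizedModule.mk_eq] at hm
    obtain ⟨c, hc⟩ := hm
    rw [← LocalizedModule.zero_mk 1, LocalizedModule.mk_eq]
    refine ⟨c, ?_⟩
    rw [smul_zero, smul_zero, one_smul] at hc ⊢
    exact h0 _ (by rwa [smul_comm])
  exists_smul_eq m m' hm := by
    induction m using LocalizedModule.induction_on with | h m s => ?_
    induction m' using LocalizedModule.induction_on with | h m' s' => ?_
    rw [algebraMap_smul, algebraMap_smul, LocalizedModule.smul'_mk, LocalizedModule.smul'_mk,
      LocalizedModule.mk_eq] at hm
    obtain ⟨c, hc⟩ := hm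
    obtain ⟨t, ht, z, hz⟩ := h (c • s' • m) (c • s • m') (by
      simpa only [smul_comm y, smul_comm x] using hc)
    refine ⟨LocalizedModule.mk z (⟨t, ht⟩ * c * s' * s), ?_⟩
    rw [algebraMap_smul, LocalizedModule.smul'_mk, ← hz, LocalizedModule.mk_eq]
    refine ⟨1, ?_⟩
    simp only [Submonoid.smul_def, Submonoid.coe_mul, smul_smul]
    congr 1
    ring

/-- A regular pair in a localization of `R`, in terms of elements of `R`. -/
theorem IsRegularPair.exists_smul_eq_of_localization {R : Type u} [CommRing R] {S : Submonoid R}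
    {x y : R}
    (h : IsRegularPair (algebraMap R (Localization S) x) (algebraMap R (Localization S) y)
      (Localization S)) (m m' : R) (hm : y * m = x * m') : ∃ t ∈ S, ∃ z, t * m = x * z := by
  obtain ⟨z, hz⟩ := h.exists_smul_eq (algebraMap R _ m) (algebraMap R _ m') (by
    simp only [smul_eq_mul, ← map_mul, hm])
  obtain ⟨z, s, rfl⟩ := IsLocalization.exists_mk'_eq S z
  have h1 : algebraMap R (Localization S) (s * m) = algebraMap R _ (x * z) := by
    rw [map_mul, hz, map_mul, smul_eq_mul, mul_left_comm, IsLocalization.mk'_spec']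
  obtain ⟨c, hc⟩ := (IsLocalization.eq_iff_exists S _).mp h1
  exact ⟨c * s, S.mul_mem c.2 s.2, c * z, by linear_combination hc⟩

namespace EdgeLabeledGraph

/-- If `x, y` is a regular pair in the localization of a domain at `S`, then it is regular on the
localization at `S` of the splines of a graph with nonzero principal labels. -/
theorem isRegularPair_splines {R : Type u} [CommRing R] [IsDomain R] {V : Type v} {E : Type w}
    [Finite V] [Finite E] (G : EdgeLabeledGraph R V E)
    (hprincipal : ∀ e, (G.label e).IsPrincipal) (hne : ∀ e, G.label e ≠ ⊥) (S : Submonoid R)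
    {x y : R} (hx : x ≠ 0)
    (hxy : ∀ m m' : R, y * m = x * m' → ∃ t ∈ S, ∃ z, t * m = x * z) :
    IsRegularPair (algebraMap R (Localization S) x) (algebraMap R (Localization S) y)
      (LocalizedModule S G.splines) := by
  classical
  cases nonempty_fintype V
  cases nonempty_fintype E
  refine .localizedModule S (fun m hm => ?_) fun m m' hm => ?_
  · ext v
    have := congrFun (congrArg Subtype.val hm) v
    exact (mul_eq_zero.mp this).resolve_left hx
  choose t ht f hf using fun v => hxy (m.1 v) (m'.1 v) (congrFun (congrArg Subtype.val hm) v)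
  choose a ha using fun e => (hprincipal e).principal
  have ha0 : ∀ e, a e ≠ 0 := fun e h => hne e (by rw [ha, h, Submodule.span_zero_singleton])
  have hmem : ∀ e r, r ∈ G.label e ↔ ∃ c, r = a e * c := fun e r => by
    rw [ha, Submodule.mem_span_singleton]
    exact exists_congr fun c => by rw [smul_eq_mul, mul_comm, eq_comm]
  -- `F` satisfies `T • m = x • F`, where `T` is the product of the denominators `t`
  let T := ∏ v, t v
  let F : V → R := fun v => (∏ u ∈ Finset.univ.erase v, t u) * f v
  have hT : ∀ v, T = (∏ u ∈ Finset.univ.erase v, t u) * t v := fun v =>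
    (Finset.prod_erase_mul _ _ (Finset.mem_univ v)).symm
  have hF : ∀ v, T * m.1 v = x * F v := fun v => by
    rw [hT v, mul_assoc, hf]; ring
  have hF' : ∀ v, y * F v = T * m'.1 v := fun v => mul_left_cancel₀ hx <| by
    have : y * m.1 v = x * m'.1 v := congrFun (congrArg Subtype.val hm) v
    linear_combination (-y) * hF v + T * this
  have hedge : ∀ e, ∃ σ ∈ S, σ * (F (G.src e) - F (G.tgt e)) ∈ G.label e := fun e => by
    obtain ⟨b, hb⟩ := (hmem e _).mp ((G.mem_splines _).mp m.2 e)
    obtain ⟨b', hb'⟩ := (hmem e _).mp ((G.mem_splines _).mp m'.2 e)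
    have h1 : x * (F (G.src e) - F (G.tgt e)) = a e * (T * b) := by
      linear_combination T * hb - hF (G.src e) + hF (G.tgt e)
    have h2 : y * (F (G.src e) - F (G.tgt e)) = a e * (T * b') := by
      linear_combination T * hb' + hF' (G.src e) - hF' (G.tgt e)
    -- Eliminating the difference of `F` between `h1` and `h2` and cancelling `a e` gives `y * (T *
    -- b) = x * (T * b')`.
    obtain ⟨σ, hσ, z, hz⟩ := hxy (T * b) (T * b') (mul_left_cancel₀ (ha0 e) (by
      linear_combination (-y) * h1 + x * h2))
    refine ⟨σ, hσ, (hmem e _).mpr ⟨z, mul_left_cancel₀ hx ?_⟩⟩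
    linear_combination σ * h1 + a e * hz
  choose σ hσ hσ' using hedge
  -- One denominator serving all edges at once.
  let P := ∏ e, σ e
  refine ⟨P * T, S.mul_mem (S.prod_mem fun e _ => hσ e) (S.prod_mem fun v _ => ht v),
    ⟨P • F, (G.mem_splines _).mpr fun e => ?_⟩, ?_⟩
  · have h := (G.label e).mul_mem_left (∏ e' ∈ Finset.univ.erase e, σ e') (hσ' e)
    rwa [← mul_assoc, Finset.prod_erase_mul _ _ (Finset.mem_univ e), mul_sub] at h
  · ext v
    change P * T * m.1 v = x * (P * F v)
    rw [mul_assoc, hF]; ring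

end EdgeLabeledGraph

/-! ### From local rings to the base ring -/

/-- A finite module of finite projective dimension over a Noetherian ring is projective if at every
maximal ideal it has a regular pair, also regular on the local ring, generating an ideal of the
local ring whose quotient has a nonzero socle. -/
theorem Module.projective_of_forall_isRegularPair {R : Type u} [CommRing R] [IsNoetherianRing R]
    [Small.{v} R] (M : ModuleCat.{v} R) [Module.Finite R M] (n : ℕ) [HasProjectiveDimensionLE M n]
    (h : ∀ (p : Ideal R) [p.IsMaximal], ∃ x y s : Localization.AtPrime p,
      IsRegularPair x y (Localization.AtPrime p) ∧ s ∉ Ideal.span {x, y} ∧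
      (∀ c ∈ maximalIdeal (Localization.AtPrime p), s * c ∈ Ideal.span {x, y}) ∧
      IsRegularPair x y (LocalizedModule p.primeCompl M)) :
    Module.Projective R M := by
  have : Module.FinitePresentation R M := Module.finitePresentation_of_finite R M
  refine Module.projective_of_localization_maximal fun p hp => ?_
  obtain ⟨x, y, s, hA, hs, hs', hM⟩ := h p
  have : IsNoetherianRing (Localization.AtPrime p) :=
    IsLocalization.isNoetherianRing p.primeCompl _ inferInstance
  have hsmall : Small.{v} (Localization.AtPrime p) :=
    small_of_surjective Localization.mkHom_surjective
  have hfin : Module.Finite (Localization.AtPrime p) (LocalizedModule p.primeCompl M) :=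
    Module.Finite.of_isLocalizedModule p.primeCompl (LocalizedModule.mkLinearMap p.primeCompl M)
  -- The freeness criterion needs a module in the universe of the ring, so the localization is
  -- replaced by a small copy.
  have hsmall' : Small.{u} (LocalizedModule p.primeCompl M) := by
    obtain ⟨k, f, hf⟩ := Module.Finite.exists_fin' (Localization.AtPrime p)
      (LocalizedModule p.primeCompl M)
    exact small_of_surjective hf
  have hsmall'' : Small.{v} (LocalizedModule p.primeCompl M) :=
    small_of_surjective (IsLocalizedModule.mk'_surjective p.primeCompl
      (LocalizedModule.mkLinearMap p.primeCompl M))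
  have hpd := M.localizedModule_hasProjectiveDimensionLE n p.primeCompl
  let e₁ : M.localizedModule p.primeCompl ≃ₗ[Localization.AtPrime p]
      LocalizedModule p.primeCompl M := Shrink.linearEquiv _ _
  let e₂ : Shrink.{u} (LocalizedModule p.primeCompl M) ≃ₗ[Localization.AtPrime p]
      LocalizedModule p.primeCompl M := Shrink.linearEquiv _ _
  let N := ModuleCat.of (Localization.AtPrime p) (Shrink.{u} (LocalizedModule p.primeCompl M))
  have : Module.Finite (Localization.AtPrime p) N := Module.Finite.equiv e₂.symm
  have : HasProjectiveDimensionLE N n :=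
    ModuleCat.hasProjectiveDimensionLE_of_linearEquiv.{v, u}
      (M := M.localizedModule p.primeCompl) (N := N) (e₁.trans e₂.symm) n
  have hfree : Module.Free (Localization.AtPrime p) N :=
    hA.free_of_hasProjectiveDimensionLE hs hs' n N (hM.of_linearEquiv e₂.symm)
  have hprojN : Module.Projective (Localization.AtPrime p)
      (Shrink.{u} (LocalizedModule p.primeCompl M)) := @Module.Projective.of_free _ _ _ _ _ hfree
  exact Module.Projective.of_equiv e₂

/-- At each maximal ideal of a Cohen–Macaulay domain all of whose maximal ideals have height two,
the regular pair of the local ring can be chosen in the base ring. -/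
theorem IsCohenMacaulay.exists_isRegularPair {R : Type u} [CommRing R] [IsDomain R]
    (hCM : IsCohenMacaulay R) (p : Ideal R) [p.IsMaximal]
    (hdim : ringKrullDim (Localization.AtPrime p) = 2) :
    ∃ (x y : R) (s : Localization.AtPrime p),
      IsRegularPair (algebraMap R (Localization.AtPrime p) x)
        (algebraMap R (Localization.AtPrime p) y) (Localization.AtPrime p) ∧
      s ∉ Ideal.span {algebraMap R (Localization.AtPrime p) x, algebraMap R _ y} ∧
      ∀ c ∈ maximalIdeal (Localization.AtPrime p),
        s * c ∈ Ideal.span {algebraMap R (Localization.AtPrime p) x, algebraMap R _ y} := by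
  obtain ⟨x, y, s, hxy, hs, hs'⟩ := (hCM.isCohenMacaulayLocal p).exists_isRegularPair hdim
  -- Denominators are units in the local ring, so numerators form a regular pair generating the same
  -- ideal.
  obtain ⟨x, a, rfl⟩ := IsLocalization.exists_mk'_eq p.primeCompl x
  obtain ⟨y, b, rfl⟩ := IsLocalization.exists_mk'_eq p.primeCompl y
  obtain ⟨ua, ha⟩ := IsLocalization.map_units (Localization.AtPrime p) a
  obtain ⟨ub, hb⟩ := IsLocalization.map_units (Localization.AtPrime p) b
  have hx : algebraMap R (Localization.AtPrime p) x = IsLocalization.mk' _ x a * ua := by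
    rw [ha, IsLocalization.mk'_spec]
  have hy : algebraMap R (Localization.AtPrime p) y = IsLocalization.mk' _ y b * ub := by
    rw [hb, IsLocalization.mk'_spec]
  have hspan : Ideal.span {algebraMap R (Localization.AtPrime p) x, algebraMap R _ y} =
      Ideal.span {IsLocalization.mk' (Localization.AtPrime p) x a, IsLocalization.mk' _ y b} := by
    rw [hx, hy, Ideal.span_insert, Ideal.span_singleton_mul_right_unit ua.isUnit,
      Ideal.span_singleton_mul_right_unit ub.isUnit, ← Ideal.span_insert]
  refine ⟨x, y, s, ?_, hspan ▸ hs, hspan ▸ hs'⟩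
  rw [hx, hy]
  exact hxy.mul_units ua ub

/-- Generalized splines over a two-dimensional Cohen–Macaulay domain, with nonzero principal
labels: finite projective dimension implies projectivity. -/
theorem mainTheorem2 {R : Type u} [CommRing R] [IsDomain R] [IsNoetherianRing R]
    (hCM : IsCohenMacaulay R)
    (hdim : ∀ (m : Ideal R) [m.IsMaximal], ringKrullDim (Localization.AtPrime m) = 2)
    {V : Type v} {E : Type w} [Finite V] [Finite E] (G : EdgeLabeledGraph R V E)
    (hprincipal : ∀ e, (G.label e).IsPrincipal) (hne : ∀ e, G.label e ≠ ⊥)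
    (hpd : ∃ n : ℕ,
      CategoryTheory.HasProjectiveDimensionLE (ModuleCat.of R G.splines) n) :
    (Module.Finite R G.splines ∧ Module.Projective R G.splines) ∧
    ((∀ (P : Type u) [AddCommGroup P] [Module R P],
        Module.Finite R P → Module.Projective R P → Module.Free R P) →
      Module.Free R G.splines) := by
  obtain ⟨n, hn⟩ := hpd
  have hfin : Module.Finite R G.splines := inferInstance
  have hproj : Module.Projective R G.splines := by
    refine Module.projective_of_forall_isRegularPair (ModuleCat.of R G.splines) n fun p hp => ?_
    obtain ⟨x, y, s, hxy, hs, hs'⟩ := hCM.exists_isRegularPair p (hdim p)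
    refine ⟨_, _, s, hxy, hs, hs', G.isRegularPair_splines hprincipal hne p.primeCompl ?_
      hxy.exists_smul_eq_of_localization⟩
    -- If `x = 0`, regularity of `x` would give `1 = 0` in the local ring.
    rintro rfl
    exact one_ne_zero (hxy.eq_zero 1 (by rw [map_zero, zero_smul]))
  refine ⟨⟨hfin, hproj⟩, fun hfree => ?_⟩
  have hsmall : Small.{u} G.splines := by
    obtain ⟨k, f, hf⟩ := Module.Finite.exists_fin' R G.splines
    exact small_of_surjective hf
  let e := Shrink.linearEquiv.{u} R G.splines
  have := hfree (Shrink.{u} G.splines) (Module.Finite.equiv e.symm)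
    (Module.Projective.of_equiv e.symm)
  exact Module.Free.of_equiv e
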